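/- \textbf{Arithmetic.} Let $u^{(l)}\ge u^{(h)}>0$ be the unit round-offs of a low and a high precision. Rounding an exact quantity $t$ (the exact result of one operation $+,-,\times,\div,\sqrt{\ }$, or a number being cast down) to precision $q\in\{l,h\}$ yields any value $(1+\delta)t$ with $|\delta|\le u^{(q)}$ (no overflow or underflow). An inner product is computed with exact products, partial sums accumulated from left to right in precision $h$, and the final sum cast down to precision $l$; every other operation is done in precision $l$. For an integer $c>0$ put $\tilde\gamma^{(q)}_k=\dfrac{c\,k\,u^{(q)}}{1-c\,k\,u^{(q)}}$. \textbf{Algorithm.} Let $A\in\mathbb{R}^{m\times n}$, $m\ge n$. For $i=1,\dots,n$: with $x$ the current content of $A[i{:}m,i]$, compute $\sigma=-\mathrm{sign}(x[1])\|x\|_2$ (with $\mathrm{sign}(0)=1$, and $\|x\|_2$ as the square root of an inner product), $v'=x[1]-\sigma$, $\beta=-v'/\sigma$ and $v=(1,x[2]/v',\dots)$ (if $x=0$: $\sigma=\beta=0$, $v=\hat e_1$); overwrite $A[i,i]$ by the computed $\sigma$ and $A[i{+}1{:}m,i]$ by $0$; replace each column $y$ of $A[i{:}m,i{+}1{:}n]$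 by the computed value of $y-(\beta\,(v^\top y))\,v$. Then $\hat R\in\mathbb{R}^{n\times n}$ is the final $A[1{:}n,1{:}n]$, and $\hat Q\in\mathbb{R}^{m\times n}$ is obtained by applying in the same way the computed transformations $n,n-1,\dots,1$ to the columns of $I_{m\times n}$, the first $n$ columns of the identity $I_m$. \textbf{Exact counterparts.} Let $P_i\in\mathbb{R}^{m\times m}$ be the exact Householder transformation, acting on rows $i,\dots,m$, that the formulas above define without rounding from the vector $x$ held by the working array at the start of step $i$ (so $P_i=I_m$ if $x=0$). Put $Q=P_1\cdots P_nI_{m\times n}$, $R=I_{m\times n}^\top P_n\cdots P_1A$, $\Delta Q=\hat Q-Q$ and $\Delta R=\hat R-R$. \textbf{Theorem.} There is an absolute integer constant $c>0$ such that the following holds for all $m\ge n$, all $u^{(l)}\ge u^{(h)}>0$ with $10cn\,u^{(l)}<1$, $cm\,u^{(h)}<1$, $\tilde\gamma^{(l)}_{10n}\le\frac12$ and $n\tilde\gamma^{(h)}_m\le\frac12$, every $A\in\mathbb{R}^{m\times n}$ of full rank $n$, and all rounding errors $\delta$ admitted above. For $j=1,\dots,n$, \[\|\Delta R[:,j]\|_2\le\big(\tilde\gamma^{(l)}_{10n}+n\tilde\gamma^{(h)}_m\big)\|A[:,j]\|_2,\qquad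 \|\Delta R\|_F\le\big(\tilde\gamma^{(l)}_{10n}+n\tilde\gamma^{(h)}_m\big)\|A\|_F,\] \[\|\Delta Q[:,j]\|_2\le\tilde\gamma^{(l)}_{10n}+n\tilde\gamma^{(h)}_m,\qquad \|\Delta Q\|_F\le n^{1/2}\big(\tilde\gamma^{(l)}_{10n}+n\tilde\gamma^{(h)}_m\big).\] -/

import Mathlib

open scoped Matrix Matrix.Norms.Frobenius

noncomputable section

namespace MPHQR

/-- Standard model of floating point arithmetic with unit round-off `u`:
`z` is an admissible computed value of the exact quantity `t` (the exact result of one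
operation `+, -, ×, ÷, √`, or a number that is cast down), i.e. `z = (1 + δ) t` with `|δ| ≤ u`. -/
def Rounds (u t z : ℝ) : Prop := ∃ δ : ℝ, |δ| ≤ u ∧ z = (1 + δ) * t

/-- `γ̃_k = c k u / (1 - c k u)` for the unit round-off `u` and the integer constant `c`. -/
def gammaTilde (c k : ℕ) (u : ℝ) : ℝ := (c * k * u) / (1 - c * k * u)

/-- The sign used in Householder vectors; it is `±1`, with value `1` at `0`. -/
def hhSign (x : ℝ) : ℝ := if 0 ≤ x then 1 else -1

/-- `z` is an admissible computed value of the inner product of `x[i:end]` and `y[i:end]`: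
the products are exact, the partial sums `s` are accumulated from left to right in the precision
with unit round-off `uh`, and the final sum is cast down to the precision with unit round-off
`ul`. -/
def MPDot {m : ℕ} (ul uh : ℝ) (i : Fin m) (x y : Fin m → ℝ) (z : ℝ) : Prop :=
  ∃ s : Fin m → ℝ,
    s i = x i * y i ∧
    (∀ r r' : Fin m, i ≤ r → (r' : ℕ) = r + 1 → Rounds uh (s r + x r' * y r') (s r')) ∧
    (∀ r : Fin m, (r : ℕ) + 1 = m → Rounds ul (s r) z)

/-- `v, β, σ` are admissible computed outputs of `hhvec(x[i:end])`:
`σ = -sign(x[i]) ‖x[i:end]‖₂`, `p = x[i] - σ`, `β = -p / σ`, `v = x[i:end] / p` with leading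
entry `1`. The vector `v` is padded by zeros above row `i`.
If `x[i:end] = 0`, then (division by `0` being `0`) `σ = 0`, `β = 0` and `v = eᵢ`, so the
resulting transformation is the identity. -/
def HHVec {m : ℕ} (ul uh : ℝ) (i : Fin m) (x v : Fin m → ℝ) (β σ : ℝ) : Prop :=
  ∃ d nrm p : ℝ,
    MPDot ul uh i x x d ∧
    Rounds ul (Real.sqrt d) nrm ∧
    σ = -hhSign (x i) * nrm ∧
    Rounds ul (x i - σ) p ∧
    Rounds ul (-p / σ) β ∧
    (∀ r, r < i → v r = 0) ∧
    v i = 1 ∧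
    (∀ r, i < r → Rounds ul (x r / p) (v r))

/-- `y` is an admissible computed value of `x - (β vᵀ x) v` on the rows `i:end`; the rows above
`i` are not touched. -/
def HHApply {m : ℕ} (ul uh : ℝ) (i : Fin m) (v : Fin m → ℝ) (β : ℝ) (x y : Fin m → ℝ) : Prop :=
  (∀ r, r < i → y r = x r) ∧
  ∃ (d q : ℝ) (w : Fin m → ℝ),
    MPDot ul uh i v x d ∧
    Rounds ul (β * d) q ∧
    (∀ r, i ≤ r → Rounds ul (q * v r) (w r)) ∧
    (∀ r, i ≤ r → Rounds ul (x r - w r) (y r))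

/-- `I_{m×n}`: the first `n` columns of the identity of size `m`. -/
def thinId (m n : ℕ) : Matrix (Fin m) (Fin n) ℝ :=
  Matrix.of fun r j => if (r : ℕ) = j then 1 else 0

/-- An execution of mixed precision Householder QR on `A`, followed by the generation of the
thin orthogonal factor. -/
structure Run {m n : ℕ} (hnm : n ≤ m) (ul uh : ℝ) (A : Matrix (Fin m) (Fin n) ℝ) where
  /-- `W k`: content of the array `A` after `k` passes through the loop. -/
  W : Fin (n + 1) → Matrix (Fin m) (Fin n) ℝ
  /-- `V i`: computed Householder vector of pass `i`. -/
  V : Fin n → Fin m → ℝ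
  /-- Computed Householder constants. -/
  β : Fin n → ℝ
  /-- Computed values of `σ`. -/
  σ : Fin n → ℝ
  /-- `X k`: computed value of `P̂ₖ₊₁ ⋯ P̂ₙ I_{m×n}`. -/
  X : Fin (n + 1) → Matrix (Fin m) (Fin n) ℝ
  W_zero : W 0 = A
  hhvec : ∀ i : Fin n,
    HHVec ul uh (Fin.castLE hnm i) (fun r => W i.castSucc r i) (V i) (β i) (σ i)
  /-- Columns already processed are not touched. -/
  W_left : ∀ (i j : Fin n), j < i → ∀ r, W i.succ r j = W i.castSucc r j
  /-- Column `i`: the diagonal entry is overwritten by `σ`, the entries below it by zeros. -/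
  W_above : ∀ (i : Fin n) (r : Fin m), (r : ℕ) < i → W i.succ r i = W i.castSucc r i
  W_diag : ∀ i : Fin n, W i.succ (Fin.castLE hnm i) i = σ i
  W_below : ∀ (i : Fin n) (r : Fin m), (i : ℕ) < r → W i.succ r i = 0
  /-- The transformation is applied to the columns to the right of column `i`. -/
  W_right : ∀ (i j : Fin n), i < j →
    HHApply ul uh (Fin.castLE hnm i) (V i) (β i)
      (fun r => W i.castSucc r j) (fun r => W i.succ r j)
  X_last : X (Fin.last n) = thinId m n
  /-- The transformations are applied to `I_{m×n}` in reverse order. -/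
  X_step : ∀ (i j : Fin n),
    HHApply ul uh (Fin.castLE hnm i) (V i) (β i)
      (fun r => X i.succ r j) (fun r => X i.castSucc r j)

/-- Exact `σ = -sign(x[i]) ‖x[i:end]‖₂`. -/
def exactSigma {m : ℕ} (i : Fin m) (x : Fin m → ℝ) : ℝ :=
  -hhSign (x i) * Real.sqrt (∑ r ∈ Finset.Ici i, x r ^ 2)

/-- Exact Householder vector of `x[i:end]`, normalised to leading entry `1`, padded by zeros. -/
def exactV {m : ℕ} (i : Fin m) (x : Fin m → ℝ) : Fin m → ℝ := fun r =>
  if r < i then 0 else if r = i then 1 else x r / (x i - exactSigma i x)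

/-- Exact Householder constant for `exactV`. -/
def exactBeta {m : ℕ} (i : Fin m) (x : Fin m → ℝ) : ℝ :=
  -(x i - exactSigma i x) / exactSigma i x

/-- Exact Householder transformation `I - β v vᵀ` zeroing `x` below row `i`
(the identity if `x[i:end] = 0`). -/
def exactP {m : ℕ} (i : Fin m) (x : Fin m → ℝ) : Matrix (Fin m) (Fin m) ℝ :=
  1 - exactBeta i x • Matrix.vecMulVec (exactV i x) (exactV i x)

namespace Run

variable {m n : ℕ} {hnm : n ≤ m} {ul uh : ℝ} {A : Matrix (Fin m) (Fin n) ℝ}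

/-- Computed `R̂ = A[1:n, 1:n]` at the end of the loop. -/
def Rhat (run : Run hnm ul uh A) : Matrix (Fin n) (Fin n) ℝ :=
  (run.W (Fin.last n)).submatrix (Fin.castLE hnm) id

/-- Computed thin factor `Q̂ = fl(P̂₁ ⋯ P̂ₙ I_{m×n})`. -/
def Qhat (run : Run hnm ul uh A) : Matrix (Fin m) (Fin n) ℝ := run.X 0

/-- `Pᵢ`: the exact Householder transformation for the `i`-th pass, i.e. for the column
that is held by the working array when pass `i` starts. -/
def P (run : Run hnm ul uh A) (i : Fin n) : Matrix (Fin m) (Fin m) ℝ :=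
  exactP (Fin.castLE hnm i) (fun r => run.W i.castSucc r i)

/-- `Q = P₁ ⋯ Pₙ I_{m×n}`. -/
def Q (run : Run hnm ul uh A) : Matrix (Fin m) (Fin n) ℝ :=
  (List.ofFn run.P).prod * thinId m n

/-- `R = I_{m×n}ᵀ Pₙ ⋯ P₁ A`. -/
def R (run : Run hnm ul uh A) : Matrix (Fin n) (Fin n) ℝ :=
  (thinId m n)ᵀ * ((List.ofFn run.P).reverse.prod * A)

end Run

/-- Euclidean norm of column `j`. -/
def colNorm {m n : ℕ} (M : Matrix (Fin m) (Fin n) ℝ) (j : Fin n) : ℝ :=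
  ‖(WithLp.toLp 2 (fun r => M r j) : EuclideanSpace ℝ (Fin m))‖

end MPHQR

end

namespace MPHQR

/-! ### Relative errors -/

/-! The exact transformation of pass `i` is built from the column that the working array really
holds at that moment. Errors of earlier passes therefore never have to be propagated through the
dependence of a Householder transformation on its input: each pass is a fixed orthogonal map plus a
local error.

The local error is governed by the single quantity ε = ul + 2·m·uh, which bounds the relative error
of a mixed precision inner product up to a factor 2 (`MPDot.abs_sub_le_two_mul`). The sign in σ
excludes cancellation, so σ, β and every entry of v carry relative errors of order ε
(`HHVec.rounds_aux`). Since |β|·‖v‖² ≤ 2, one rounded application differs from the exact one by at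
most 123ε‖x‖ (`HHApply.l2_sub_le`).

Orthogonal maps do not amplify these local errors, so over n passes they add up to at most (1 +
123ε)^n − 1 relative to the starting column (`l2_sub_reverse_prod_mulVec_le` for R,
`l2_sub_prod_mulVec_le` for Q). This is at most 246·n·ε, which a large enough c absorbs into the γ̃
terms. The Frobenius bounds follow column by column. -/

theorem rounds_iff {u t z : ℝ} (hu : 0 ≤ u) : Rounds u t z ↔ |z - t| ≤ u * |t| := by
  constructor
  · rintro ⟨δ, hδ, rfl⟩
    rw [show (1 + δ) * t - t = δ * t by ring, abs_mul]
    gcongr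
  · intro h
    by_cases ht : t = 0
    · subst ht
      refine ⟨0, by simpa using hu, ?_⟩
      have : z = 0 := by simpa using h
      simp [this]
    · refine ⟨(z - t) / t, ?_, by field_simp; ring⟩
      rw [abs_div]
      exact div_le_of_le_mul₀ (abs_nonneg _) hu h

theorem Rounds.mono {u u' t z : ℝ} (h : Rounds u t z) (hu : u ≤ u') : Rounds u' t z := by
  obtain ⟨δ, hδ, rfl⟩ := h
  exact ⟨δ, hδ.trans hu, rfl⟩

theorem Rounds.abs_le {u t z : ℝ} (h : Rounds u t z) : |z| ≤ (1 + u) * |t| := by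
  obtain ⟨δ, hδ, rfl⟩ := h
  rw [abs_mul]
  gcongr
  calc |1 + δ| ≤ |1| + |δ| := abs_add_le _ _
    _ ≤ 1 + u := by simpa using hδ

theorem abs_one_add_mul_one_add_sub_one_le {a b u v : ℝ} (ha : |a| ≤ u) (hb : |b| ≤ v) :
    |a + b + a * b| ≤ u + v + u * v := by
  calc |a + b + a * b| ≤ |a| + |b| + |a * b| :=
        (abs_add_le _ _).trans (by gcongr; exact abs_add_le _ _)
    _ ≤ u + v + u * v := by
        rw [abs_mul]
        have := (abs_nonneg a).trans ha
        gcongr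

theorem Rounds.mul {u v s t y z : ℝ} (h : Rounds u s y) (h' : Rounds v t z) :
    Rounds (u + v + u * v) (s * t) (y * z) := by
  obtain ⟨δ, hδ, rfl⟩ := h
  obtain ⟨δ', hδ', rfl⟩ := h'
  exact ⟨δ + δ' + δ * δ', abs_one_add_mul_one_add_sub_one_le hδ hδ', by ring⟩

theorem Rounds.trans {u v t y z : ℝ} (h : Rounds u t y) (h' : Rounds v y z) :
    Rounds (u + v + u * v) t z := by
  obtain ⟨δ, hδ, rfl⟩ := h
  obtain ⟨δ', hδ', rfl⟩ := h'
  exact ⟨δ + δ' + δ * δ', abs_one_add_mul_one_add_sub_one_le hδ hδ', by ring⟩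

/-- The factor 2 bounds 1 / (1 + δ'). The value `t = 0` is allowed: it forces `z = 0`, and both
quotients are then 0. This lets a vanishing pivot column pass through the error analysis without a
separate case. -/
theorem Rounds.div {u v s t y z : ℝ} (h : Rounds u s y) (h' : Rounds v t z) (hv : v ≤ 1 / 2) :
    Rounds (2 * (u + v)) (s / t) (y / z) := by
  obtain ⟨δ, hδ, rfl⟩ := h
  obtain ⟨δ', hδ', rfl⟩ := h'
  have hpos : 1 / 2 ≤ 1 + δ' := by linarith [neg_abs_le δ']
  have h0 : 0 < 1 + δ' := by linarith
  refine ⟨(δ - δ') / (1 + δ'), ?_, ?_⟩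
  · rw [abs_div, abs_of_pos h0, div_le_iff₀ h0]
    have h1 : |δ - δ'| ≤ u + v := (abs_sub _ _).trans (add_le_add hδ hδ')
    nlinarith [(abs_nonneg _).trans h1]
  · rw [show 1 + (δ - δ') / (1 + δ') = (1 + δ) / (1 + δ') by field_simp; ring, mul_div_mul_comm]

theorem Rounds.sqrt {u t z : ℝ} (h : Rounds u t z) (hu : u ≤ 1) : Rounds u √t √z := by
  obtain ⟨δ, hδ, rfl⟩ := h
  have h0 : 0 ≤ 1 + δ := by linarith [neg_abs_le δ]
  refine ⟨√(1 + δ) - 1, le_trans ?_ hδ, ?_⟩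
  · have hs := Real.sqrt_nonneg (1 + δ)
    have he : (√(1 + δ) - 1) * (√(1 + δ) + 1) = δ := by nlinarith [Real.mul_self_sqrt h0]
    calc |√(1 + δ) - 1| ≤ |√(1 + δ) - 1| * |√(1 + δ) + 1| := by
          refine le_mul_of_one_le_right (abs_nonneg _) ?_
          rw [abs_of_nonneg (by linarith)]
          linarith
      _ = |δ| := by rw [← abs_mul, he]
  · rw [Real.sqrt_mul h0]
    ring

theorem Rounds.neg {u t z : ℝ} (h : Rounds u t z) : Rounds u (-t) (-z) := by
  obtain ⟨δ, hδ, rfl⟩ := h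
  exact ⟨δ, hδ, by ring⟩

theorem Rounds.const_mul {u t z : ℝ} (a : ℝ) (h : Rounds u t z) : Rounds u (a * t) (a * z) := by
  obtain ⟨δ, hδ, rfl⟩ := h
  exact ⟨δ, hδ, by ring⟩

theorem rounds_refl {u : ℝ} (hu : 0 ≤ u) (t : ℝ) : Rounds u t t := ⟨0, by simpa using hu, by simp⟩

/-- Comparison with the exponential, using |exp t − 1| ≤ 2|t| for |t| ≤ 1. -/
theorem one_add_pow_sub_one_le {x : ℝ} {k : ℕ} (hx : 0 ≤ x) (h : k * x ≤ 1) :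
    (1 + x) ^ k - 1 ≤ 2 * (k * x) := by
  have h0 : 0 ≤ k * x := by positivity
  have h1 : (1 + x) ^ k ≤ Real.exp (k * x) := by
    rw [Real.exp_nat_mul]
    gcongr
    linarith [Real.add_one_le_exp x]
  have h2 := Real.abs_exp_sub_one_le (x := k * x) (by rwa [abs_of_nonneg h0])
  rw [abs_of_nonneg h0] at h2
  linarith [le_abs_self (Real.exp (k * x) - 1)]

/-! ### The Euclidean norm of a tuple -/

/-- Euclidean norm of a tuple of reals. -/
noncomputable def l2 {ι : Type*} [Fintype ι] (x : ι → ℝ) : ℝ :=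
  ‖(WithLp.toLp 2 x : EuclideanSpace ℝ ι)‖

section l2

variable {ι : Type*} [Fintype ι]

theorem l2_eq_sqrt (x : ι → ℝ) : l2 x = √(∑ r, x r ^ 2) := by
  simp [l2, EuclideanSpace.norm_eq]

theorem l2_nonneg (x : ι → ℝ) : 0 ≤ l2 x := norm_nonneg _

theorem l2_sq (x : ι → ℝ) : l2 x ^ 2 = ∑ r, x r ^ 2 := by
  rw [l2_eq_sqrt, Real.sq_sqrt (by positivity)]

theorem l2_add_le (x y : ι → ℝ) : l2 (x + y) ≤ l2 x + l2 y := by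
  simpa [l2] using norm_add_le (WithLp.toLp 2 x : EuclideanSpace ℝ ι) (WithLp.toLp 2 y)

theorem l2_smul (a : ℝ) (x : ι → ℝ) : l2 (a • x) = |a| * l2 x := by
  simpa [l2] using norm_smul a (WithLp.toLp 2 x : EuclideanSpace ℝ ι)

theorem l2_mono {x y : ι → ℝ} (h : ∀ r, |x r| ≤ |y r|) : l2 x ≤ l2 y := by
  rw [l2_eq_sqrt, l2_eq_sqrt]
  exact Real.sqrt_le_sqrt (Finset.sum_le_sum fun r _ => sq_le_sq.2 (h r))

theorem l2_abs (x : ι → ℝ) : l2 (fun r => |x r|) = l2 x :=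
  le_antisymm (l2_mono fun r => by simp) (l2_mono fun r => by simp)

theorem sum_abs_mul_abs_le_l2_mul_l2 (x y : ι → ℝ) : ∑ r, |x r| * |y r| ≤ l2 x * l2 y := by
  rw [l2_eq_sqrt, l2_eq_sqrt]
  simpa using Real.sum_mul_le_sqrt_mul_sqrt Finset.univ (fun r => |x r|) (fun r => |y r|)

theorem l2_le_of_abs_le_add {x y z : ι → ℝ} {a b : ℝ} (ha : 0 ≤ a) (hb : 0 ≤ b)
    (h : ∀ r, |x r| ≤ a * |y r| + b * |z r|) : l2 x ≤ a * l2 y + b * l2 z := by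
  calc l2 x ≤ l2 (a • (fun r => |y r|) + b • fun r => |z r|) :=
        l2_mono fun r => (h r).trans (by simpa using le_abs_self _)
    _ ≤ l2 (a • fun r => |y r|) + l2 (b • fun r => |z r|) := l2_add_le _ _
    _ = a * l2 y + b * l2 z := by
        rw [l2_smul, l2_smul, l2_abs, l2_abs, abs_of_nonneg ha, abs_of_nonneg hb]

end l2

/-! ### Inner products -/

section Dot

variable {m : ℕ}

/-- The leading product is exact and each of the following `k` additions contributes one factor 1 +
uh, hence the exponent `k`. -/
theorem abs_partial_sum_sub_le {uh : ℝ} (huh : 0 ≤ uh) {i : Fin m} {x y s : Fin m → ℝ}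
    (h0 : s i = x i * y i)
    (h1 : ∀ r r' : Fin m, i ≤ r → (r' : ℕ) = r + 1 → Rounds uh (s r + x r' * y r') (s r'))
    (k : ℕ) (hk : (i : ℕ) + k < m) :
    |s ⟨i + k, hk⟩ - ∑ r ∈ Finset.Icc i ⟨i + k, hk⟩, x r * y r| ≤
      ((1 + uh) ^ k - 1) * ∑ r ∈ Finset.Icc i ⟨i + k, hk⟩, |x r| * |y r| := by
  induction k with
  | zero =>
    have : (⟨i + 0, hk⟩ : Fin m) = i := by ext; simp
    rw [this]
    simp [h0]
  | succ k ih =>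
    have hk' : (i : ℕ) + k < m := by omega
    specialize ih hk'
    set a : Fin m := ⟨i + k, hk'⟩ with ha
    set b : Fin m := ⟨i + (k + 1), hk⟩ with hb
    have hIcc : Finset.Icc i b = insert b (Finset.Icc i a) := by
      ext r
      simp only [Finset.mem_Icc, Finset.mem_insert, Fin.le_def, Fin.ext_iff, ha, hb]
      omega
    have hnot : b ∉ Finset.Icc i a := by
      simp only [Finset.mem_Icc, Fin.le_def, ha, hb]
      omega
    rw [hIcc, Finset.sum_insert hnot, Finset.sum_insert hnot]
    have hr := (rounds_iff huh).1
      (h1 a b (by simp [Fin.le_def, ha]) (by simp only [ha, hb]; omega))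
    set S := ∑ r ∈ Finset.Icc i a, x r * y r
    set T := ∑ r ∈ Finset.Icc i a, |x r| * |y r|
    have hST : |S| ≤ T := (Finset.abs_sum_le_sum_abs _ _).trans_eq (by simp [T, abs_mul])
    have hxy : |x b * y b| = |x b| * |y b| := abs_mul _ _
    have hpow : 1 ≤ (1 + uh) ^ k := one_le_pow₀ (by linarith)
    have e1 : |s b - (x b * y b + S)| ≤ |s b - (s a + x b * y b)| + |s a - S| := by
      rw [show s b - (x b * y b + S) = (s b - (s a + x b * y b)) + (s a - S) by ring]
      exact abs_add_le _ _
    have e2 : |s a + x b * y b| ≤ |s a - S| + (T + |x b| * |y b|) := by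
      rw [show s a + x b * y b = (s a - S) + (S + x b * y b) by ring]
      refine (abs_add_le _ _).trans ?_
      gcongr
      refine (abs_add_le _ _).trans ?_
      rw [hxy]
      gcongr
    have e3 := mul_le_mul_of_nonneg_left e2 huh
    have e4 := mul_le_mul_of_nonneg_left ih (by linarith : 0 ≤ 1 + uh)
    -- The newest product is rounded only once; charging it (1 + uh)^(k+1) − 1 instead of uh leaves
    -- exactly this slack.
    have e5 : 0 ≤ ((1 + uh) ^ k - 1) * (1 + uh) * (|x b| * |y b|) := by
      have : 0 ≤ (1 + uh) ^ k - 1 := by linarith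
      positivity
    rw [pow_succ]
    nlinarith

theorem MPDot.abs_sub_le {ul uh : ℝ} (hul : 0 ≤ ul) (huh : 0 ≤ uh) {i : Fin m}
    {x y : Fin m → ℝ} {z : ℝ} (h : MPDot ul uh i x y z) :
    |z - ∑ r ∈ Finset.Ici i, x r * y r| ≤
      ((1 + ul) * (1 + uh) ^ m - 1) * ∑ r ∈ Finset.Ici i, |x r| * |y r| := by
  obtain ⟨s, h0, h1, h2⟩ := h
  have hi := i.2
  have hk : (i : ℕ) + (m - 1 - i) < m := by omega
  have key := abs_partial_sum_sub_le huh h0 h1 _ hk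
  set a : Fin m := ⟨i + (m - 1 - i), hk⟩ with ha
  have hIcc : Finset.Icc i a = Finset.Ici i := by
    ext r
    have := r.2
    simp only [Finset.mem_Icc, Finset.mem_Ici, Fin.le_def, ha]
    omega
  rw [hIcc] at key
  have hr := (rounds_iff hul).1 (h2 a (by simp only [ha]; omega))
  set S := ∑ r ∈ Finset.Ici i, x r * y r
  set T := ∑ r ∈ Finset.Ici i, |x r| * |y r|
  have hT : 0 ≤ T := Finset.sum_nonneg fun r _ => by positivity
  have hST : |S| ≤ T := (Finset.abs_sum_le_sum_abs _ _).trans_eq (by simp [T, abs_mul])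
  -- The true number of additions, m − 1 − i, is enlarged to m to get a bound independent of the
  -- row.
  have hpow : (1 + uh) ^ (m - 1 - (i : ℕ)) ≤ (1 + uh) ^ m :=
    pow_le_pow_right₀ (by linarith) (by omega)
  have key' : |s a - S| ≤ ((1 + uh) ^ m - 1) * T := key.trans (by gcongr)
  have e1 : |z - S| ≤ |z - s a| + |s a - S| := _root_.abs_sub_le _ _ _
  have e2 : |s a| ≤ |s a - S| + T := by
    have := abs_add_le (s a - S) S
    rw [sub_add_cancel] at this
    linarith
  have e3 := mul_le_mul_of_nonneg_left e2 hul
  have e4 := mul_le_mul_of_nonneg_left key' (by linarith : 0 ≤ 1 + ul)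
  linarith

end Dot

/-! ### The exact Householder transformation -/

section Exact

variable {m : ℕ} (i : Fin m) (x : Fin m → ℝ)

theorem hhSign_mul_self (a : ℝ) : hhSign a * hhSign a = 1 := by
  unfold hhSign; split_ifs <;> simp

theorem hhSign_mul_abs (a : ℝ) : hhSign a * |a| = a := by
  unfold hhSign
  split_ifs with h
  · simp [abs_of_nonneg h]
  · simp [abs_of_neg (not_le.1 h)]

theorem abs_hhSign (a : ℝ) : |hhSign a| = 1 := by
  unfold hhSign; split_ifs <;> simp

theorem exactP_mulVec (y : Fin m → ℝ) (r : Fin m) :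
    (exactP i x *ᵥ y) r = y r - exactBeta i x * (exactV i x ⬝ᵥ y) * exactV i x r := by
  simp [exactP, Matrix.sub_mulVec, Matrix.smul_mulVec, Matrix.vecMulVec_mulVec]
  ring

theorem exactV_of_lt {r : Fin m} (h : r < i) : exactV i x r = 0 := by simp [exactV, h]

theorem exactV_self : exactV i x i = 1 := by simp [exactV]

theorem exactV_of_gt {r : Fin m} (h : i < r) :
    exactV i x r = x r / (x i - exactSigma i x) := by
  simp [exactV, h.ne', h.not_gt]

/-- Sums against a vector that vanishes above row `i` only see the rows `i:end`. -/
theorem sum_Ici_eq_sum {f : Fin m → ℝ} (hf : ∀ r, r < i → f r = 0) :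
    ∑ r ∈ Finset.Ici i, f r = ∑ r, f r :=
  Finset.sum_subset (Finset.subset_univ _) fun r _ hr => hf r (by simpa using hr)

theorem sum_Ici_eq_add_sum_Ioi (f : Fin m → ℝ) :
    ∑ r ∈ Finset.Ici i, f r = f i + ∑ r ∈ Finset.Ioi i, f r := by
  rw [← Finset.Ioi_insert, Finset.sum_insert (by simp)]

/-- Either `x[i:end]` vanishes, or the exact quantities are non-degenerate. -/
theorem exactSigma_cases :
    (exactSigma i x = 0 ∧ ∀ r, i ≤ r → x r = 0) ∨
      (exactSigma i x ≠ 0 ∧ x i - exactSigma i x ≠ 0) := by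
  have hsum : 0 ≤ ∑ r ∈ Finset.Ici i, x r ^ 2 := by positivity
  have hs : hhSign (x i) ≠ 0 := fun h => by simpa [h] using hhSign_mul_self (x i)
  by_cases h : exactSigma i x = 0
  · refine Or.inl ⟨h, fun r hr => ?_⟩
    rw [exactSigma, mul_eq_zero, neg_eq_zero, or_iff_right hs, Real.sqrt_eq_zero hsum,
      Finset.sum_eq_zero_iff_of_nonneg fun r _ => sq_nonneg _] at h
    simpa using h r (by simpa using hr)
  · refine Or.inr ⟨h, fun h0 => h ?_⟩
    have h1 : hhSign (x i) * (|x i| + √(∑ r ∈ Finset.Ici i, x r ^ 2)) = 0 := by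
      rw [mul_add, hhSign_mul_abs]
      rw [exactSigma] at h0
      linarith
    have h2 := (mul_eq_zero.1 h1).resolve_left hs
    have h3 : √(∑ r ∈ Finset.Ici i, x r ^ 2) = 0 := by
      linarith [abs_nonneg (x i), Real.sqrt_nonneg (∑ r ∈ Finset.Ici i, x r ^ 2)]
    simp [exactSigma, h3]

theorem exactSigma_sq : exactSigma i x ^ 2 = ∑ r ∈ Finset.Ici i, x r ^ 2 := by
  have hsum : 0 ≤ ∑ r ∈ Finset.Ici i, x r ^ 2 := by positivity
  rw [exactSigma, mul_pow, neg_sq, sq (hhSign _), hhSign_mul_self, Real.sq_sqrt hsum, one_mul]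

/-- The tail contributes (σ² − x i²) / (x i − σ) = −(x i + σ), because σ² = ‖x[i:end]‖². -/
theorem exactV_dotProduct_self_of_ne (h1 : x i - exactSigma i x ≠ 0) :
    exactV i x ⬝ᵥ x = -exactSigma i x := by
  have e : exactV i x ⬝ᵥ x = ∑ r ∈ Finset.Ici i, exactV i x r * x r :=
    (sum_Ici_eq_sum i fun r hr => by simp [exactV_of_lt i x hr]).symm
  have e2 : ∑ r ∈ Finset.Ioi i, exactV i x r * x r =
      (∑ r ∈ Finset.Ioi i, x r ^ 2) / (x i - exactSigma i x) := by
    rw [Finset.sum_div]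
    refine Finset.sum_congr rfl fun r hr => ?_
    rw [exactV_of_gt i x (by simpa using hr)]
    ring
  have hS := exactSigma_sq i x
  rw [sum_Ici_eq_add_sum_Ioi] at hS
  rw [e, sum_Ici_eq_add_sum_Ioi, e2, exactV_self]
  field_simp
  linarith

theorem exactV_dotProduct_exactV_of_ne (h1 : x i - exactSigma i x ≠ 0) :
    exactV i x ⬝ᵥ exactV i x = -2 * exactSigma i x / (x i - exactSigma i x) := by
  have e : exactV i x ⬝ᵥ exactV i x = ∑ r ∈ Finset.Ici i, exactV i x r * exactV i x r :=
    (sum_Ici_eq_sum i fun r hr => by simp [exactV_of_lt i x hr]).symm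
  have e2 : ∑ r ∈ Finset.Ioi i, exactV i x r * exactV i x r =
      (∑ r ∈ Finset.Ioi i, x r ^ 2) / (x i - exactSigma i x) ^ 2 := by
    rw [Finset.sum_div]
    refine Finset.sum_congr rfl fun r hr => ?_
    rw [exactV_of_gt i x (by simpa using hr), div_mul_div_comm, ← sq, ← sq]
  have hS := exactSigma_sq i x
  rw [sum_Ici_eq_add_sum_Ioi] at hS
  rw [e, sum_Ici_eq_add_sum_Ioi, e2, exactV_self]
  field_simp
  linarith

/-- The two alternatives are the identity and a genuine reflection; they are all that orthogonality
needs. -/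
theorem exactBeta_cases :
    exactBeta i x = 0 ∨ exactBeta i x * (exactV i x ⬝ᵥ exactV i x) = 2 := by
  rcases exactSigma_cases i x with ⟨h, -⟩ | ⟨h, h1⟩
  · left; simp [exactBeta, h]
  · right
    rw [exactV_dotProduct_exactV_of_ne i x h1, exactBeta]
    field_simp

theorem abs_exactBeta_mul_le : |exactBeta i x| * l2 (exactV i x) ^ 2 ≤ 2 := by
  have e : l2 (exactV i x) ^ 2 = exactV i x ⬝ᵥ exactV i x := by
    rw [l2_sq, dotProduct]
    exact Finset.sum_congr rfl fun r _ => sq _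
  rcases exactBeta_cases i x with h | h
  · simp [h]
  · have h2 : |exactBeta i x| * |l2 (exactV i x) ^ 2| = 2 := by rw [← abs_mul, e, h]; simp
    rw [abs_of_nonneg (sq_nonneg (l2 (exactV i x)))] at h2
    exact h2.le

theorem l2_exactP_mulVec (y : Fin m → ℝ) : l2 (exactP i x *ᵥ y) = l2 y := by
  rw [l2_eq_sqrt, l2_eq_sqrt]
  congr 1
  set β := exactBeta i x with hβ
  set v := exactV i x with hv
  have h : β * (β * (v ⬝ᵥ v) - 2) = 0 := by
    rcases exactBeta_cases i x with h | h
    · rw [← hβ] at h; simp [h]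
    · rw [← hβ, ← hv] at h; simp [h]
  have e : ∑ r, (exactP i x *ᵥ y) r ^ 2 =
      ∑ r, y r ^ 2 - 2 * (β * (v ⬝ᵥ y)) * (v ⬝ᵥ y) + (β * (v ⬝ᵥ y)) ^ 2 * (v ⬝ᵥ v) := by
    rw [dotProduct.eq_1 v v]
    nth_rewrite 2 [dotProduct.eq_1 v y]
    rw [Finset.mul_sum, Finset.mul_sum, ← Finset.sum_sub_distrib, ← Finset.sum_add_distrib]
    refine Finset.sum_congr rfl fun r _ => ?_
    rw [exactP_mulVec, ← hβ, ← hv]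
    ring
  rw [e]
  -- The squared norm changes by β(β v·v − 2)(v·y)², which `h` annihilates in both cases.
  linear_combination (v ⬝ᵥ y) ^ 2 * h

theorem exactP_mulVec_self (r : Fin m) :
    (exactP i x *ᵥ x) r = if r < i then x r else if r = i then exactSigma i x else 0 := by
  rw [exactP_mulVec]
  rcases exactSigma_cases i x with ⟨h, h0⟩ | ⟨h, h1⟩
  · have hβ : exactBeta i x = 0 := by simp [exactBeta, h]
    rw [hβ, h]
    rcases lt_or_ge r i with hr | hr
    · simp [hr]
    · simp [hr.not_gt, h0 r hr]
  · rw [exactV_dotProduct_self_of_ne i x h1, exactBeta]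
    rcases lt_trichotomy r i with hr | rfl | hr
    · simp [hr, exactV_of_lt i x hr]
    · simp only [lt_self_iff_false, ↓reduceIte, exactV_self]
      field_simp
      ring
    · simp only [hr.not_gt, hr.ne', ↓reduceIte, exactV_of_gt i x hr]
      field_simp
      ring

/-- The transformation does not change vectors that vanish from row `i` on. -/
theorem exactP_mulVec_of_zero {y : Fin m → ℝ} (hy : ∀ r, i ≤ r → y r = 0) :
    exactP i x *ᵥ y = y := by
  have : exactV i x ⬝ᵥ y = 0 := by
    refine Finset.sum_eq_zero fun r _ => ?_
    rcases lt_or_ge r i with hr | hr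
    · simp [exactV_of_lt i x hr]
    · simp [hy r hr]
  ext r
  rw [exactP_mulVec, this]
  simp

end Exact



/-! ### One rounded transformation -/

section Step

variable {m : ℕ} {ul uh ε : ℝ} {i : Fin m}

theorem one_add_mul_one_add_pow_sub_one_le (hul : 0 ≤ ul) (huh : 0 ≤ uh)
    (hε : ul + 2 * (m * uh) ≤ ε) (hε1 : ε ≤ 1 / 500) :
    (1 + ul) * (1 + uh) ^ m - 1 ≤ 2 * ε := by
  have h0 : 0 ≤ m * uh := by positivity
  have h1 := one_add_pow_sub_one_le huh (k := m) (by linarith)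
  have h2 := mul_le_mul_of_nonneg_left h1 hul
  have h3 : ul * (2 * (m * uh)) ≤ 1 * ε := mul_le_mul (by linarith) (by linarith) (by linarith)
    zero_le_one
  linarith

theorem MPDot.abs_sub_le_two_mul (hul : 0 ≤ ul) (huh : 0 ≤ uh)
    (hε : ul + 2 * (m * uh) ≤ ε) (hε1 : ε ≤ 1 / 500) {x y : Fin m → ℝ} {z : ℝ}
    (h : MPDot ul uh i x y z) :
    |z - ∑ r ∈ Finset.Ici i, x r * y r| ≤ 2 * ε * ∑ r ∈ Finset.Ici i, |x r| * |y r| := by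
  refine (h.abs_sub_le hul huh).trans ?_
  gcongr
  exact one_add_mul_one_add_pow_sub_one_le hul huh hε hε1

/-- The constants follow the operations: 2ε for the squared norm, 4ε after root and rounding, 6ε for
p, 2(6 + 4)ε = 20ε for the quotient behind β and 2·6ε = 12ε for the one behind v. Each final
rounding adds ε, and ε ≤ 1/500 absorbs the second-order terms. -/
theorem HHVec.rounds_aux (hul : 0 ≤ ul) (huh : 0 ≤ uh)
    (hε : ul + 2 * (m * uh) ≤ ε) (hε1 : ε ≤ 1 / 500) {x v : Fin m → ℝ} {β σ : ℝ}
    (h : HHVec ul uh i x v β σ) :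
    Rounds (4 * ε) (exactSigma i x) σ ∧ Rounds (22 * ε) (exactBeta i x) β ∧
      ∀ r, Rounds (14 * ε) (exactV i x r) (v r) := by
  have hε0 : 0 ≤ ε := by linarith [show 0 ≤ m * uh by positivity]
  have hulε : ul ≤ ε := by linarith [show 0 ≤ m * uh by positivity]
  have hεε : ε * ε ≤ 1 / 500 * ε := by gcongr
  obtain ⟨d, nrm, p, hd, hn, rfl, hp, hβ, hv0, hv1, hv⟩ := h
  have hd' := hd.abs_sub_le_two_mul hul huh hε hε1
  simp only [abs_mul_abs_self] at hd'
  have hdr : Rounds (2 * ε) (∑ r ∈ Finset.Ici i, x r ^ 2) d := by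
    rw [rounds_iff (by positivity), abs_of_nonneg (a := ∑ r ∈ Finset.Ici i, x r ^ 2)
      (by positivity)]
    simpa only [sq] using hd'
  have hnr : Rounds (4 * ε) √(∑ r ∈ Finset.Ici i, x r ^ 2) nrm :=
    ((hdr.sqrt (by linarith)).trans (hn.mono hulε)).mono (by nlinarith)
  have hσ : Rounds (4 * ε) (exactSigma i x) (-hhSign (x i) * nrm) := hnr.const_mul _
  -- No cancellation: |x i − σ| = |x i| + |σ|, so the relative error of σ passes unchanged to the
  -- difference.
  have hsub : Rounds (4 * ε) (x i - exactSigma i x) (x i - -hhSign (x i) * nrm) := by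
    have h1 := (rounds_iff (by positivity)).1 hσ
    rw [rounds_iff (by positivity)]
    have e : |x i - exactSigma i x| = |x i| + |exactSigma i x| := by
      have : x i - exactSigma i x =
          hhSign (x i) * (|x i| + √(∑ r ∈ Finset.Ici i, x r ^ 2)) := by
        rw [mul_add, hhSign_mul_abs, exactSigma]
        ring
      rw [this, abs_mul, abs_hhSign, exactSigma, abs_mul, abs_neg, abs_hhSign,
        abs_of_nonneg (Real.sqrt_nonneg _), abs_of_nonneg (by positivity), one_mul, one_mul]
    rw [e, sub_sub_sub_cancel_left, abs_sub_comm]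
    have : 0 ≤ 4 * ε * |x i| := by positivity
    linarith
  have hpr : Rounds (6 * ε) (x i - exactSigma i x) p :=
    (hsub.trans (hp.mono hulε)).mono (by nlinarith)
  refine ⟨hσ, ?_, fun r => ?_⟩
  · exact ((hpr.neg.div hσ (by linarith)).trans (hβ.mono hulε)).mono (by nlinarith)
  · rcases lt_trichotomy r i with hr | rfl | hr
    · rw [exactV_of_lt i x hr, hv0 r hr]
      exact rounds_refl (by positivity) _
    · rw [exactV_self, hv1]
      exact rounds_refl (by positivity) _
    · rw [exactV_of_gt i x hr]
      exact (((rounds_refl le_rfl (x r)).div hpr (by linarith)).trans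
        ((hv r hr).mono hulε)).mono (by nlinarith)

theorem HHVec.abs_sigma_sub_le (hul : 0 ≤ ul) (huh : 0 ≤ uh)
    (hε : ul + 2 * (m * uh) ≤ ε) (hε1 : ε ≤ 1 / 500) {x v : Fin m → ℝ} {β σ : ℝ}
    (h : HHVec ul uh i x v β σ) : |σ - exactSigma i x| ≤ 4 * ε * |exactSigma i x| := by
  have hε0 : 0 ≤ ε := by linarith [show 0 ≤ m * uh by positivity]
  exact (rounds_iff (by positivity)).1 (h.rounds_aux hul huh hε hε1).1

/-- Inner products with the computed Householder vector. -/
theorem MPDot.abs_sub_exactV_dotProduct_le (hul : 0 ≤ ul) (huh : 0 ≤ uh)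
    (hε : ul + 2 * (m * uh) ≤ ε) (hε1 : ε ≤ 1 / 500) {a v x : Fin m → ℝ} {d : ℝ}
    (hv : ∀ r, Rounds (14 * ε) (exactV i a r) (v r)) (h : MPDot ul uh i v x d) :
    |d - exactV i a ⬝ᵥ x| ≤ 17 * ε * (l2 (exactV i a) * l2 x) := by
  have hε0 : 0 ≤ ε := by linarith [show 0 ≤ m * uh by positivity]
  have hεε : ε * ε ≤ 1 / 500 * ε := by gcongr
  have hv0 : ∀ r, r < i → v r = 0 := fun r hr => by
    obtain ⟨δ, -, hδ⟩ := hv r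
    rw [hδ, exactV_of_lt i a hr, mul_zero]
  have h1 := h.abs_sub_le_two_mul hul huh hε hε1
  rw [sum_Ici_eq_sum i fun r hr => by simp [hv0 r hr],
    sum_Ici_eq_sum i fun r hr => by simp [hv0 r hr]] at h1
  set T := ∑ r, |exactV i a r| * |x r| with hT
  have hT0 : 0 ≤ T := Finset.sum_nonneg fun r _ => by positivity
  have hTle : T ≤ l2 (exactV i a) * l2 x := sum_abs_mul_abs_le_l2_mul_l2 _ _
  have h2 : ∑ r, |v r| * |x r| ≤ (1 + 14 * ε) * T := by
    rw [hT, Finset.mul_sum]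
    refine Finset.sum_le_sum fun r _ => ?_
    rw [← mul_assoc]
    gcongr
    exact (hv r).abs_le
  have h3 : |∑ r, v r * x r - exactV i a ⬝ᵥ x| ≤ 14 * ε * T := by
    rw [dotProduct, ← Finset.sum_sub_distrib, hT, Finset.mul_sum]
    refine (Finset.abs_sum_le_sum_abs _ _).trans ?_
    gcongr with r
    rw [← sub_mul, abs_mul, ← mul_assoc]
    gcongr
    exact (rounds_iff (by positivity)).1 (hv r)
  calc |d - exactV i a ⬝ᵥ x| ≤ 2 * ε * ((1 + 14 * ε) * T) + 14 * ε * T :=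
        (_root_.abs_sub_le _ (∑ r, v r * x r) _).trans
          (add_le_add (h1.trans (by gcongr)) h3)
    _ = (16 * ε + 28 * (ε * ε)) * T := by ring
    _ ≤ 17 * ε * T := by gcongr; linarith
    _ ≤ _ := by gcongr

/-- The rounding of the last subtraction is charged to the exact result, whose norm is ‖x‖; all
other errors are proportional to |β|‖v‖‖x‖·|v r|. In norm this gives ε + 61ε·|β|‖v‖² ≤ 123ε,
relative to ‖x‖. -/
theorem HHApply.l2_sub_le (hul : 0 ≤ ul) (huh : 0 ≤ uh)
    (hε : ul + 2 * (m * uh) ≤ ε) (hε1 : ε ≤ 1 / 500) {a v x y : Fin m → ℝ} {β σ : ℝ}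
    (hvec : HHVec ul uh i a v β σ) (h : HHApply ul uh i v β x y) :
    l2 (y - exactP i a *ᵥ x) ≤ 123 * ε * l2 x := by
  have hε0 : 0 ≤ ε := by linarith [show 0 ≤ m * uh by positivity]
  have hulε : ul ≤ ε := by linarith [show 0 ≤ m * uh by positivity]
  have hεε : ε * ε ≤ 1 / 500 * ε := by gcongr
  obtain ⟨-, hβ, hv⟩ := hvec.rounds_aux hul huh hε hε1
  obtain ⟨hy0, d, q, w, hd, hq, hw, hy⟩ := h
  have hdd := hd.abs_sub_exactV_dotProduct_le hul huh hε hε1 hv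
  set b := exactBeta i a
  set V := exactV i a with hV
  set N := l2 V * l2 x with hN
  have hN0 : 0 ≤ N := mul_nonneg (l2_nonneg _) (l2_nonneg _)
  have hdN : |d| ≤ (1 + 17 * ε) * N := by
    have h1 : |V ⬝ᵥ x| ≤ N :=
      (Finset.abs_sum_le_sum_abs _ _).trans
        ((Finset.sum_le_sum fun r _ => (abs_mul _ _).le).trans (sum_abs_mul_abs_le_l2_mul_l2 _ _))
    have h2 := abs_add_le (d - V ⬝ᵥ x) (V ⬝ᵥ x)
    rw [sub_add_cancel] at h2
    linarith
  have hqr : Rounds (24 * ε) (b * d) q :=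
    (((hβ.mul (rounds_refl le_rfl d))).trans (hq.mono hulε)).mono (by nlinarith)
  have hwr : ∀ r, i ≤ r → |w r - b * (V ⬝ᵥ x) * V r| ≤ 60 * ε * N * |b| * |V r| := by
    intro r hr
    -- 24ε from q, 14ε from v, ε from this rounding, the rest for products of errors.
    have h1 : Rounds (41 * ε) (b * d * V r) (w r) :=
      ((hqr.mul (hv r)).trans ((hw r hr).mono hulε)).mono (by nlinarith)
    have h2 := (rounds_iff (by positivity)).1 h1
    have h3 : |b * d * V r - b * (V ⬝ᵥ x) * V r| ≤ 17 * ε * N * (|b| * |V r|) := by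
      rw [show b * d * V r - b * (V ⬝ᵥ x) * V r = (d - V ⬝ᵥ x) * (b * V r) by ring, abs_mul,
        abs_mul b]
      gcongr
    have h4 : |b * d * V r| ≤ (1 + 17 * ε) * N * (|b| * |V r|) := by
      rw [show b * d * V r = d * (b * V r) by ring, abs_mul, abs_mul b]
      gcongr
    calc |w r - b * (V ⬝ᵥ x) * V r|
        ≤ 41 * ε * ((1 + 17 * ε) * N * (|b| * |V r|)) + 17 * ε * N * (|b| * |V r|) :=
          (_root_.abs_sub_le _ _ _).trans (add_le_add (h2.trans (by gcongr)) h3)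
      _ = (58 * ε + 697 * (ε * ε)) * (N * (|b| * |V r|)) := by ring
      _ ≤ 60 * ε * (N * (|b| * |V r|)) := by gcongr; linarith
      _ = _ := by ring
  have key : ∀ r, |(y - exactP i a *ᵥ x) r| ≤
      ε * |(exactP i a *ᵥ x) r| + 61 * ε * N * |b| * |V r| := by
    intro r
    rw [Pi.sub_apply, exactP_mulVec]
    rcases lt_or_ge r i with hr | hr
    · rw [hy0 r hr, ← hV, hV, exactV_of_lt i a hr, mul_zero, sub_zero, sub_self, abs_zero]
      positivity
    · have h1 := (rounds_iff hε0).1 ((hy r hr).mono hulε)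
      have h2 := hwr r hr
      set t := b * (V ⬝ᵥ x) * V r
      have h3 : |y r - (x r - t)| ≤ |y r - (x r - w r)| + |w r - t| := by
        have := _root_.abs_sub_le (y r) (x r - w r) (x r - t)
        rwa [sub_sub_sub_cancel_left, abs_sub_comm t] at this
      have h4 : |x r - w r| ≤ |x r - t| + |w r - t| := by
        have := _root_.abs_sub_le (x r) t (w r)
        rwa [abs_sub_comm t] at this
      have h5 := mul_le_mul_of_nonneg_left h4 hε0
      have h6 := mul_le_mul_of_nonneg_left h2 (by linarith : 0 ≤ 1 + ε)
      have h7 : ε * (60 * ε * N * |b| * |V r|) ≤ 1 * ε * N * |b| * |V r| := by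
        rw [show ε * (60 * ε * N * |b| * |V r|) = 60 * (ε * ε) * (N * |b| * |V r|) by ring,
          show 1 * ε * N * |b| * |V r| = ε * (N * |b| * |V r|) by ring]
        exact mul_le_mul_of_nonneg_right (by linarith) (by positivity)
      linarith
  have hfin := l2_le_of_abs_le_add hε0 (by positivity) key
  rw [l2_exactP_mulVec] at hfin
  refine hfin.trans ?_
  have h8 := mul_le_mul_of_nonneg_left (abs_exactBeta_mul_le i a)
    (mul_nonneg hε0 (l2_nonneg x))
  rw [hN]
  linarith

/-- Overwriting the pivot column by `σ` and zeros. -/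
theorem HHVec.l2_sub_le (hul : 0 ≤ ul) (huh : 0 ≤ uh)
    (hε : ul + 2 * (m * uh) ≤ ε) (hε1 : ε ≤ 1 / 500) {x v y : Fin m → ℝ} {β σ : ℝ}
    (hvec : HHVec ul uh i x v β σ) (h0 : ∀ r, r < i → y r = x r) (h1 : y i = σ)
    (h2 : ∀ r, i < r → y r = 0) :
    l2 (y - exactP i x *ᵥ x) ≤ 123 * ε * l2 x := by
  have hε0 : 0 ≤ ε := by linarith [show 0 ≤ m * uh by positivity]
  -- The overwritten column differs from the exact image only in row `i`. The constant 4 is loosened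
  -- to 123 at the end so that every column obeys the same bound.
  have h : l2 (y - exactP i x *ᵥ x) ≤ 4 * ε * l2 (exactP i x *ᵥ x) + 0 * l2 x := by
    refine l2_le_of_abs_le_add (by positivity) le_rfl fun r => ?_
    rw [Pi.sub_apply, exactP_mulVec_self, zero_mul, add_zero]
    rcases lt_trichotomy r i with hr | rfl | hr
    · simp only [hr, ↓reduceIte, h0 r hr, sub_self, abs_zero]
      positivity
    · simpa [h1] using hvec.abs_sigma_sub_le hul huh hε hε1
    · simp [hr.not_gt, hr.ne', h2 r hr]
  rw [l2_exactP_mulVec] at h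
  have := mul_nonneg hε0 (l2_nonneg x)
  linarith

end Step

/-! ### Accumulation of errors over a sequence of isometries -/

section Accumulate

variable {m : ℕ} {τ : ℝ}

theorem l2_list_prod_mulVec {L : List (Matrix (Fin m) (Fin m) ℝ)}
    (hL : ∀ M ∈ L, ∀ y, l2 (M *ᵥ y) = l2 y) (y : Fin m → ℝ) : l2 (L.prod *ᵥ y) = l2 y := by
  induction L with
  | nil => simp
  | cons M L ih =>
    rw [List.prod_cons, ← Matrix.mulVec_mulVec, hL M (by simp),
      ih fun M' h => hL M' (List.mem_cons_of_mem _ h)]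

/-- A local error is carried on by exact isometries only, so it keeps its norm; the powers of 1 + τ
record the possible growth of the computed vectors. The induction peels off `P 0`, the
transformation applied earliest. -/
theorem l2_sub_reverse_prod_mulVec_le (hτ : 0 ≤ τ) {n : ℕ}
    (P : Fin n → Matrix (Fin m) (Fin m) ℝ) (hP : ∀ i y, l2 (P i *ᵥ y) = l2 y)
    (y : Fin (n + 1) → Fin m → ℝ)
    (h : ∀ i : Fin n, l2 (y i.succ - P i *ᵥ y i.castSucc) ≤ τ * l2 (y i.castSucc)) :
    l2 (y (Fin.last n) - (List.ofFn P).reverse.prod *ᵥ y 0) ≤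
      ((1 + τ) ^ n - 1) * l2 (y 0) := by
  induction n with
  | zero => simp [l2_eq_sqrt]
  | succ n ih =>
    have ih' := ih (fun i => P i.succ) (fun i => hP i.succ) (fun k => y k.succ)
      (fun i => h i.succ)
    simp only [Fin.succ_last] at ih'
    set L := (List.ofFn fun i : Fin n => P i.succ).reverse with hL
    have hLi : ∀ z, l2 (L.prod *ᵥ z) = l2 z := fun z => l2_list_prod_mulVec (fun M hM => by
      obtain ⟨i, rfl⟩ : ∃ i : Fin n, P i.succ = M := by simpa [hL, List.mem_ofFn] using hM
      exact hP _) z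
    have h0 := h 0
    simp only [Fin.castSucc_zero] at h0
    rw [List.ofFn_succ, List.reverse_cons, List.prod_append, List.prod_singleton, ← hL]
    have e : y (Fin.last (n + 1)) - (L.prod * P 0) *ᵥ y 0 =
        (y (Fin.last (n + 1)) - L.prod *ᵥ y (Fin.succ 0)) +
          L.prod *ᵥ (y (Fin.succ 0) - P 0 *ᵥ y 0) := by
      rw [Matrix.mulVec_sub, Matrix.mulVec_mulVec]
      abel
    have h1 : l2 (y (Fin.succ 0)) ≤ (1 + τ) * l2 (y 0) := by
      have := l2_add_le (y (Fin.succ 0) - P 0 *ᵥ y 0) (P 0 *ᵥ y 0)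
      rw [sub_add_cancel, hP] at this
      linarith
    have hpow : 0 ≤ (1 + τ) ^ n - 1 := by linarith [one_le_pow₀ (n := n) (by linarith : 1 ≤ 1 + τ)]
    rw [e]
    refine (l2_add_le _ _).trans ?_
    rw [hLi, pow_succ]
    have h2 := mul_le_mul_of_nonneg_left h1 hpow
    linarith

/-- The same with the vectors indexed backwards: `P 0` is now applied last, so its local error is
relative to a vector that may already have grown by (1 + τ)^n. -/
theorem l2_sub_prod_mulVec_le (hτ : 0 ≤ τ) {n : ℕ}
    (P : Fin n → Matrix (Fin m) (Fin m) ℝ) (hP : ∀ i y, l2 (P i *ᵥ y) = l2 y)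
    (y : Fin (n + 1) → Fin m → ℝ)
    (h : ∀ i : Fin n, l2 (y i.castSucc - P i *ᵥ y i.succ) ≤ τ * l2 (y i.succ)) :
    l2 (y 0 - (List.ofFn P).prod *ᵥ y (Fin.last n)) ≤
      ((1 + τ) ^ n - 1) * l2 (y (Fin.last n)) := by
  induction n with
  | zero => simp [l2_eq_sqrt]
  | succ n ih =>
    have ih' := ih (fun i => P i.succ) (fun i => hP i.succ) (fun k => y k.succ)
      (fun i => h i.succ)
    simp only [Fin.succ_last] at ih'
    set L := List.ofFn fun i : Fin n => P i.succ with hL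
    set z := y (Fin.last (n + 1))
    have hLi : l2 (L.prod *ᵥ z) = l2 z := l2_list_prod_mulVec (fun M hM => by
      obtain ⟨i, rfl⟩ : ∃ i : Fin n, P i.succ = M := by simpa [hL, List.mem_ofFn] using hM
      exact hP _) z
    have h0 := h 0
    simp only [Fin.castSucc_zero] at h0
    rw [List.ofFn_succ, List.prod_cons, ← hL]
    have e : y 0 - (P 0 * L.prod) *ᵥ z =
        (y 0 - P 0 *ᵥ y (Fin.succ 0)) + P 0 *ᵥ (y (Fin.succ 0) - L.prod *ᵥ z) := by
      rw [Matrix.mulVec_sub, Matrix.mulVec_mulVec]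
      abel
    have h1 : l2 (y (Fin.succ 0)) ≤ (1 + τ) ^ n * l2 z := by
      have := l2_add_le (y (Fin.succ 0) - L.prod *ᵥ z) (L.prod *ᵥ z)
      rw [sub_add_cancel, hLi] at this
      linarith
    rw [e]
    refine (l2_add_le _ _).trans ?_
    rw [hP, pow_succ]
    have h2 := mul_le_mul_of_nonneg_left h1 hτ
    linarith

end Accumulate

/-! ### The whole factorization -/

namespace Run

variable {m n : ℕ} {hnm : n ≤ m} {ul uh ε : ℝ} {A : Matrix (Fin m) (Fin n) ℝ}

theorem l2_P_mulVec (run : Run hnm ul uh A) (i : Fin n) (y : Fin m → ℝ) :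
    l2 (run.P i *ᵥ y) = l2 y := l2_exactP_mulVec _ _ _

/-- Processed columns are upper triangular. -/
theorem W_eq_zero (run : Run hnm ul uh A) (k : Fin (n + 1)) :
    ∀ (j : Fin n) (r : Fin m), (j : ℕ) < k → (j : ℕ) < r → run.W k r j = 0 := by
  induction k using Fin.induction with
  | zero => intro j r h; simp at h
  | succ i ih =>
    intro j r hj hr
    rcases lt_or_eq_of_le (Nat.lt_succ_iff.1 (by simpa using hj) : (j : ℕ) ≤ i) with h | h
    · rw [run.W_left i j h r]
      exact ih j r (by simpa using h) hr
    · obtain rfl : j = i := Fin.ext h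
      exact run.W_below j r hr

/-- Finished columns are included so that each column can be followed through all n passes. They
vanish from row `i` on, hence the exact transformation fixes them and their local error is 0. -/
theorem l2_W_step_le (run : Run hnm ul uh A) (hul : 0 ≤ ul) (huh : 0 ≤ uh)
    (hε : ul + 2 * (m * uh) ≤ ε) (hε1 : ε ≤ 1 / 500) (i j : Fin n) :
    l2 ((fun r => run.W i.succ r j) - run.P i *ᵥ fun r => run.W i.castSucc r j) ≤
      123 * ε * l2 fun r => run.W i.castSucc r j := by
  have hε0 : 0 ≤ ε := by linarith [show 0 ≤ m * uh by positivity]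
  rcases lt_trichotomy j i with h | rfl | h
  · rw [P, exactP_mulVec_of_zero]
    · have : ((fun r => run.W i.succ r j) - fun r => run.W i.castSucc r j) = 0 := by
        ext r
        simp [run.W_left i j h r]
      rw [this]
      have h0 : l2 (0 : Fin m → ℝ) = 0 := by simp [l2_eq_sqrt]
      rw [h0]
      exact mul_nonneg (by positivity) (l2_nonneg _)
    · intro r hr
      exact run.W_eq_zero _ j r h (lt_of_lt_of_le h hr)
  · exact (run.hhvec j).l2_sub_le hul huh hε hε1 (fun r hr => run.W_above j r hr)
      (run.W_diag j) fun r hr => run.W_below j r hr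
  · exact (run.W_right i j h).l2_sub_le hul huh hε hε1 (run.hhvec i)

theorem l2_X_step_le (run : Run hnm ul uh A) (hul : 0 ≤ ul) (huh : 0 ≤ uh)
    (hε : ul + 2 * (m * uh) ≤ ε) (hε1 : ε ≤ 1 / 500) (i j : Fin n) :
    l2 ((fun r => run.X i.castSucc r j) - run.P i *ᵥ fun r => run.X i.succ r j) ≤
      123 * ε * l2 fun r => run.X i.succ r j :=
  (run.X_step i j).l2_sub_le hul huh hε hε1 (run.hhvec i)

theorem thinId_transpose_mul {p : ℕ} (hnm : n ≤ m) (M : Matrix (Fin m) (Fin p) ℝ) :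
    (thinId m n)ᵀ * M = M.submatrix (Fin.castLE hnm) id := by
  ext a b
  rw [Matrix.mul_apply, Finset.sum_eq_single (Fin.castLE hnm a)]
  · simp [thinId]
  · intro r _ hr
    have : (r : ℕ) ≠ a := fun h => hr (Fin.ext (by simpa using h))
    simp [thinId, this]
  · simp

theorem l2_thinId_col (hnm : n ≤ m) (j : Fin n) : l2 (fun r => thinId m n r j) = 1 := by
  rw [l2_eq_sqrt, Finset.sum_eq_single (Fin.castLE hnm j)]
  · simp [thinId]
  · intro r _ hr
    have : (r : ℕ) ≠ j := fun h => hr (Fin.ext (by simpa using h))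
    simp [thinId, this]
  · simp

theorem l2_comp_le_of_injective {ι κ : Type*} [Fintype ι] [Fintype κ] {f : κ → ι}
    (hf : f.Injective) (x : ι → ℝ) : l2 (x ∘ f) ≤ l2 x := by
  classical
  rw [l2_eq_sqrt, l2_eq_sqrt]
  refine Real.sqrt_le_sqrt ?_
  have := Finset.sum_image (s := Finset.univ) (f := fun r => x r ^ 2) (g := f)
    (fun a _ b _ h => hf h)
  simp only [Function.comp_apply]
  rw [← this]
  exact Finset.sum_le_sum_of_subset_of_nonneg (Finset.subset_univ _) fun _ _ _ => sq_nonneg _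

theorem colNorm_Rhat_sub_R_le (run : Run hnm ul uh A) (hul : 0 ≤ ul) (huh : 0 ≤ uh)
    (hε : ul + 2 * (m * uh) ≤ ε) (hε1 : ε ≤ 1 / 500) (j : Fin n) :
    colNorm (run.Rhat - run.R) j ≤ ((1 + 123 * ε) ^ n - 1) * colNorm A j := by
  have hε0 : 0 ≤ ε := by linarith [show 0 ≤ m * uh by positivity]
  have h := l2_sub_reverse_prod_mulVec_le (by positivity) run.P run.l2_P_mulVec
    (fun k r => run.W k r j) fun i => run.l2_W_step_le hul huh hε hε1 i j
  simp only [run.W_zero] at h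
  -- Passing to the leading n rows does not increase the norm.
  refine le_trans (le_of_eq ?_) ((l2_comp_le_of_injective
    (Fin.castLE_injective hnm) _).trans h)
  rw [R, thinId_transpose_mul hnm]
  rfl

theorem colNorm_Qhat_sub_Q_le (run : Run hnm ul uh A) (hul : 0 ≤ ul) (huh : 0 ≤ uh)
    (hε : ul + 2 * (m * uh) ≤ ε) (hε1 : ε ≤ 1 / 500) (j : Fin n) :
    colNorm (run.Qhat - run.Q) j ≤ (1 + 123 * ε) ^ n - 1 := by
  have hε0 : 0 ≤ ε := by linarith [show 0 ≤ m * uh by positivity]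
  have h := l2_sub_prod_mulVec_le (by positivity) run.P run.l2_P_mulVec
    (fun k r => run.X k r j) fun i => run.l2_X_step_le hul huh hε hε1 i j
  simp only [run.X_last, l2_thinId_col hnm, mul_one] at h
  exact h

end Run

/-! ### Frobenius bounds from column bounds, and the choice of the constant -/

theorem frobenius_norm_sq_eq_sum_colNorm_sq {m n : ℕ} (M : Matrix (Fin m) (Fin n) ℝ) :
    ‖M‖ ^ 2 = ∑ j, colNorm M j ^ 2 := by
  have e : ∀ j, colNorm M j ^ 2 = ∑ r, M r j ^ 2 := fun j => l2_sq fun r => M r j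
  have h : ‖M‖ = √(∑ r, ∑ j, M r j ^ 2) := by
    rw [Matrix.frobenius_norm_def, Real.sqrt_eq_rpow]
    simp
  rw [h, Real.sq_sqrt (by positivity), Finset.sum_comm]
  exact Finset.sum_congr rfl fun j _ => (e j).symm

theorem frobenius_norm_le_of_colNorm_le {m p n : ℕ} {M : Matrix (Fin m) (Fin n) ℝ}
    {B : Matrix (Fin p) (Fin n) ℝ} {b : ℝ} (hb : 0 ≤ b)
    (h : ∀ j, colNorm M j ≤ b * colNorm B j) : ‖M‖ ≤ b * ‖B‖ := by
  refine abs_le_of_sq_le_sq' ?_ (by positivity) |>.2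
  rw [mul_pow, frobenius_norm_sq_eq_sum_colNorm_sq, frobenius_norm_sq_eq_sum_colNorm_sq,
    Finset.mul_sum]
  refine Finset.sum_le_sum fun j _ => ?_
  rw [← mul_pow]
  exact pow_le_pow_left₀ (norm_nonneg _) (h j) 2

theorem frobenius_norm_le_sqrt_mul {m n : ℕ} {M : Matrix (Fin m) (Fin n) ℝ} {b : ℝ} (hb : 0 ≤ b)
    (h : ∀ j, colNorm M j ≤ b) : ‖M‖ ≤ √n * b := by
  refine abs_le_of_sq_le_sq' ?_ (by positivity) |>.2
  rw [mul_pow, Real.sq_sqrt n.cast_nonneg, frobenius_norm_sq_eq_sum_colNorm_sq]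
  calc ∑ j, colNorm M j ^ 2 ≤ ∑ _j : Fin n, b ^ 2 :=
        Finset.sum_le_sum fun j _ => pow_le_pow_left₀ (norm_nonneg _) (h j) 2
    _ = n * b ^ 2 := by simp

theorem mul_le_gammaTilde {c k : ℕ} {u : ℝ} (hu : 0 ≤ u) (h : c * k * u < 1) :
    c * k * u ≤ gammaTilde c k u := by
  have h0 : 0 ≤ c * k * u := by positivity
  rw [gammaTilde, le_div_iff₀ (by linarith)]
  nlinarith

end MPHQR

theorem mainTheorem1 :
    ∃ c : ℕ, 0 < c ∧
      ∀ (m n : ℕ) (hnm : n ≤ m) (ul uh : ℝ), 0 < uh → uh ≤ ul →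
        (c : ℝ) * (10 * n : ℕ) * ul < 1 → MPHQR.gammaTilde c (10 * n) ul ≤ 1 / 2 →
        (c : ℝ) * m * uh < 1 → n * MPHQR.gammaTilde c m uh ≤ 1 / 2 →
        ∀ A : Matrix (Fin m) (Fin n) ℝ, A.rank = n →
          ∀ run : MPHQR.Run hnm ul uh A,
            (∀ j : Fin n, MPHQR.colNorm (run.Rhat - run.R) j ≤
              (MPHQR.gammaTilde c (10 * n) ul + n * MPHQR.gammaTilde c m uh) *
                MPHQR.colNorm A j) ∧
            ‖run.Rhat - run.R‖ ≤
              (MPHQR.gammaTilde c (10 * n) ul + n * MPHQR.gammaTilde c m uh) * ‖A‖ ∧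
            (∀ j : Fin n, MPHQR.colNorm (run.Qhat - run.Q) j ≤
              MPHQR.gammaTilde c (10 * n) ul + n * MPHQR.gammaTilde c m uh) ∧
            ‖run.Qhat - run.Q‖ ≤
              Real.sqrt n *
                (MPHQR.gammaTilde c (10 * n) ul + n * MPHQR.gammaTilde c m uh) := by
  -- The accumulated error is at most 246·n·ul + 492·n·m·uh, while γ̃ ≥ c·k·u gives 10000·n·ul and
  -- 1000·n·m·uh on the other side.
  refine ⟨1000, by norm_num, fun m n hnm ul uh huh hle hl hγl hh hγh A _ run => ?_⟩
  have hul : 0 < ul := huh.trans_le hle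
  have gl := MPHQR.mul_le_gammaTilde hul.le hl
  have gh := MPHQR.mul_le_gammaTilde huh.le hh
  have gh' := mul_le_mul_of_nonneg_left gh n.cast_nonneg
  set γl := MPHQR.gammaTilde 1000 (10 * n) ul
  set γh := MPHQR.gammaTilde 1000 m uh
  push_cast at gl gh'
  have hl0 : 0 ≤ n * ul := by positivity
  have hh0 : 0 ≤ n * (m * uh) := by positivity
  have hb : 0 ≤ γl + n * γh := by linarith
  set ε := ul + 2 * (m * uh) with hε
  -- A column index guarantees n ≥ 1, which is needed to deduce that ε is small from the bounds on
  -- n·ul and n·m·uh.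
  have hcol : ∀ _j : Fin n, ε ≤ 1 / 500 ∧ (1 + 123 * ε) ^ n - 1 ≤ γl + n * γh := by
    intro j
    have hn : (1 : ℝ) ≤ n := by exact_mod_cast j.pos
    have h1 : ul ≤ n * ul := le_mul_of_one_le_left hul.le hn
    have h2 : m * uh ≤ n * (m * uh) := le_mul_of_one_le_left (by positivity) hn
    have hε0 : 0 ≤ ε := by positivity
    have e : n * (123 * ε) = 123 * (n * ul) + 246 * (n * (m * uh)) := by rw [hε]; ring
    refine ⟨by linarith, ?_⟩
    have := MPHQR.one_add_pow_sub_one_le (x := 123 * ε) (k := n) (by positivity) (by linarith)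
    linarith
  have hR : ∀ j : Fin n, MPHQR.colNorm (run.Rhat - run.R) j ≤
      (γl + n * γh) * MPHQR.colNorm A j := fun j =>
    (run.colNorm_Rhat_sub_R_le hul.le huh.le hε.ge (hcol j).1 j).trans
      (mul_le_mul_of_nonneg_right (hcol j).2 (norm_nonneg _))
  have hQ : ∀ j : Fin n, MPHQR.colNorm (run.Qhat - run.Q) j ≤ γl + n * γh := fun j =>
    (run.colNorm_Qhat_sub_Q_le hul.le huh.le hε.ge (hcol j).1 j).trans (hcol j).2
  exact ⟨hR, MPHQR.frobenius_norm_le_of_colNorm_le hb hR, hQ,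
    MPHQR.frobenius_norm_le_sqrt_mul hb hQ⟩
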